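/- Let $G$ be a finite simple connected non-complete graph that is strongly regular with parameters $(v,k,\lambda,\mu)$: it has $v$ vertices, is $k$-regular, any two adjacent vertices have exactly $\lambda$ common neighbours, and any two distinct non-adjacent vertices have exactly $\mu$ common neighbours. Suppose that $\max(\lambda,\mu)\le k/4$. Then there is a set $S\subseteq V(G)$ such that $G\setminus S$ is disconnected and every connected component of $G\setminus S$ has at least two vertices, and the minimum size $\kappa_2(G)$ of such a set is $$\kappa_2(G)=2k-\lambda-2.$$ -/

import Mathlib

/-- The removal of the vertex set `S` disconnects `G` into non-singleton components: the graph
induced on the complement of `S` has at least two connected components, and each of its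
components has at least two vertices. -/
def SimpleGraph.DisconnectsIntoNonsingletons {V : Type*} (G : SimpleGraph V) (S : Finset V) :
    Prop :=
  Nontrivial (G.induce {x : V | x ∉ S}).ConnectedComponent ∧
    ∀ C : (G.induce {x : V | x ∉ S}).ConnectedComponent, C.supp.Nontrivial

/-- `G.IsKappaTwo m` says that `κ₂(G)` exists and equals `m`: the minimum size of a vertex set
whose removal disconnects `G` into non-singleton components is attained and equals `m`. The
value is an integer, so that it can be compared with a difference free of truncation. -/
def SimpleGraph.IsKappaTwo {V : Type*} (G : SimpleGraph V) (m : ℤ) : Prop :=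
  IsLeast {s : ℤ | ∃ S : Finset V, G.DisconnectsIntoNonsingletons S ∧ (S.card : ℤ) = s} m

open Finset

namespace SimpleGraph

/-! Deleting the neighbours of an edge other than its ends isolates that edge, and `2 * μ < k`
leaves no singleton elsewhere; this gives the upper bound. For the lower bound, suppose fewer
vertices `S` separate `A` from `B`. Each side then contains a path on three vertices, whose
neighbourhoods force it to have at least `k / 2 + 3` vertices (`three_mul_le_of_separated`). A
Cauchy–Schwarz form of the eigenvalue separation bound (`four_mul_card_mul_card_le`) makes `|A| |B|`
small relative to `|S|`, and the parameter equation turns this into a false cubic inequality in `k`.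
-/

theorem IsSRGWith.card_neighborFinset {V : Type*} [Fintype V] {G : SimpleGraph V}
    [DecidableRel G.Adj] {v k l m : ℕ} (h : G.IsSRGWith v k l m) (x : V) :
    #(G.neighborFinset x) = k := h.regular x

/-- The parameter equation of a strongly regular graph, free of truncated subtraction. -/
theorem IsSRGWith.real_param_eq {V : Type*} [Fintype V] [Nonempty V] {G : SimpleGraph V}
    [DecidableRel G.Adj] {v k l m : ℕ} (h : G.IsSRGWith v k l m) (hlk : l < k) :
    (k : ℝ) * (k - l - 1) = (v - k - 1) * m := by
  have hkv : k < v := by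
    rw [← h.card, ← h.regular (Classical.arbitrary V)]
    exact G.degree_lt_card_verts _
  obtain ⟨i, rfl⟩ := Nat.exists_eq_add_of_lt hlk
  obtain ⟨j, rfl⟩ := Nat.exists_eq_add_of_lt hkv
  have := IsSRGWith.param_eq G h (by omega)
  rw [show l + i + 1 - l - 1 = i by omega, show l + i + 1 + j + 1 - (l + i + 1) - 1 = j by omega]
    at this
  have h' : ((l + i + 1 : ℕ) : ℝ) * i = j * m := by exact_mod_cast this
  push_cast at h' ⊢
  linarith

/-! ### Counting and the separation bound -/

section Counting

variable {V : Type*} [Fintype V] [DecidableEq V] {G : SimpleGraph V} [DecidableRel G.Adj]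
  {v k l m : ℕ}

/-- The square of the adjacency matrix of a strongly regular graph, entrywise. -/
theorem IsSRGWith.sum_adjMatrix_mul (h : G.IsSRGWith v k l m) (y z : V) :
    ∑ x, G.adjMatrix ℝ x y * G.adjMatrix ℝ x z =
      (m : ℝ) + (if y = z then (k : ℝ) - m else 0) + ((l : ℝ) - m) * G.adjMatrix ℝ y z := by
  have h1 := congrFun (congrFun (h.matrix_eq (α := ℝ)) y) z
  rw [pow_two, Matrix.mul_apply, Matrix.add_apply, Matrix.add_apply, Matrix.smul_apply,
    Matrix.smul_apply, Matrix.smul_apply] at h1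
  have h2 : ∀ x, G.adjMatrix ℝ x y = G.adjMatrix ℝ y x := fun x => by
    simp [adjMatrix_apply, G.adj_comm]
  simp only [h2]
  rw [h1]
  by_cases hyz : y = z
  · subst hyz
    simp
  · by_cases ha : G.Adj y z <;> simp [hyz, ha]

/-- If `A` and `B` are disjoint vertex sets of a strongly regular graph with no edges between
them, then `|A| |B|` is bounded in terms of the number of remaining vertices. -/
theorem IsSRGWith.four_mul_card_mul_card_le (h : G.IsSRGWith v k l m) (hlk : l < k)
    {A B : Finset V} (hB : B.Nonempty) (hAB : Disjoint A B) (hno : ∀ x ∈ A, ∀ y ∈ B, ¬ G.Adj x y) :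
    4 * (m : ℝ) * #A * #B ≤
      (((l : ℝ) - m) ^ 2 + 4 * ((k : ℝ) - m)) * ((v : ℝ) - #A - #B) := by
  -- With `M` the adjacency matrix, this `c` cancels the linear term: `(M - c)² = (c² + k - m) I + m
  -- J`. Below, `f = (M - c) 1_B` vanishes on `A`, so Cauchy–Schwarz is applied on `Aᶜ` only.
  set c : ℝ := ((l : ℝ) - m) / 2 with hc
  set d : V → ℝ := fun x => ∑ y ∈ B, G.adjMatrix ℝ x y with hd
  set f : V → ℝ := fun x => d x - c * (if x ∈ B then 1 else 0) with hf
  have hbpos : (0 : ℝ) < #B := by exact_mod_cast hB.card_pos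
  have hsumd : ∑ x, d x = k * #B := by
    rw [show ∑ x, d x = ∑ y ∈ B, ∑ x, G.adjMatrix ℝ x y from sum_comm]
    have : ∀ y ∈ B, ∑ x, G.adjMatrix ℝ x y = k := fun y _ => by
      have := h.regular y
      simp only [adjMatrix_apply, G.adj_comm _ y]
      rw [← this, ← card_neighborFinset_eq_degree, neighborFinset_eq_filter]
      simp
    rw [sum_congr rfl this]
    simp [mul_comm]
  have hsumf : ∑ x, f x = (k - c) * #B := by
    simp only [hf, sum_sub_distrib, hsumd, ← mul_sum]
    simp
    ring
  have hsqd : ∑ x, d x ^ 2 =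
      m * (#B : ℝ) ^ 2 + (k - m) * #B + (l - m) * ∑ y ∈ B, d y := by
    have : ∀ x, d x ^ 2 = ∑ y ∈ B, ∑ z ∈ B, G.adjMatrix ℝ x y * G.adjMatrix ℝ x z := fun x => by
      rw [pow_two, hd, sum_mul_sum]
    rw [sum_congr rfl fun x _ => this x, sum_comm]
    have h2 : ∀ y ∈ B, ∑ x, ∑ z ∈ B, G.adjMatrix ℝ x y * G.adjMatrix ℝ x z =
        m * #B + (k - m) + (l - m) * d y := fun y hy => by
      rw [sum_comm, sum_congr rfl fun z _ => h.sum_adjMatrix_mul y z]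
      rw [sum_add_distrib, sum_add_distrib, ← mul_sum, sum_ite_eq, if_pos hy]
      simp [hd, mul_comm]
    rw [sum_congr rfl h2, sum_add_distrib, sum_add_distrib, ← mul_sum B d]
    simp only [sum_const, nsmul_eq_mul]
    ring
  have hsqf : ∑ x, f x ^ 2 = (c ^ 2 + (k - m)) * #B + m * (#B : ℝ) ^ 2 := by
    have : ∀ x, f x ^ 2 = d x ^ 2 - 2 * c * (if x ∈ B then d x else 0) +
        c ^ 2 * (if x ∈ B then 1 else 0) := fun x => by
      simp only [hf]; split_ifs <;> ring
    rw [sum_congr rfl fun x _ => this x, sum_add_distrib, sum_sub_distrib, ← mul_sum, ← mul_sum,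
      hsqd]
    simp
    rw [hc]; ring
  have hfA : ∀ x ∈ A, f x = 0 := fun x hx => by
    have h1 : d x = 0 := sum_eq_zero fun y hy => by simp [hno x hx y hy]
    have h2 : x ∉ B := fun hxB => Finset.disjoint_left.1 hAB hx hxB
    simp [hf, h1, h2]
  have h1 : ∑ x ∈ Aᶜ, f x = (k - c) * #B := by
    rw [← hsumf, ← sum_add_sum_compl A, sum_eq_zero hfA, zero_add]
  have h2 : ∑ x ∈ Aᶜ, f x ^ 2 = (c ^ 2 + (k - m)) * #B + m * (#B : ℝ) ^ 2 := by
    rw [← hsqf, ← sum_add_sum_compl A (fun x => f x ^ 2),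
      sum_eq_zero (s := A) fun x hx => by simp [hfA x hx], zero_add]
  have hcs := sq_sum_le_card_mul_sum_sq (s := Aᶜ) (f := f)
  have hcard : (#Aᶜ : ℝ) = v - #A := by
    rw [card_compl, h.card, Nat.cast_sub (h.card ▸ card_le_univ A)]
  rw [h1, h2, hcard] at hcs
  have : Nonempty V := ⟨hB.choose⟩
  have hpar := h.real_param_eq hlk
  have key : (k - c) ^ 2 * #B ≤ (v - #A) * ((c ^ 2 + (k - m)) + m * #B) := by
    refine le_of_mul_le_mul_right ?_ hbpos
    linarith
  have hlc : (l : ℝ) = m + 2 * c := by rw [hc]; ring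
  rw [hlc] at hpar ⊢
  -- The same matrix identity evaluated on the all-ones vector; it is equivalent to the parameter
  -- equation.
  have hkc : (k - c) ^ 2 = c ^ 2 + (k - m) + v * m := by linarith
  rw [hkc] at key
  linarith

theorem IsSRGWith.card_inter_of_adj (h : G.IsSRGWith v k l m) {x y : V} (hxy : G.Adj x y) :
    #(G.neighborFinset x ∩ G.neighborFinset y) = l := by
  rw [← h.of_adj x y hxy, ← Set.toFinset_card]
  congr 1
  ext z
  simp [mem_commonNeighbors]

theorem IsSRGWith.card_inter_of_not_adj (h : G.IsSRGWith v k l m) {x y : V} (hne : x ≠ y)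
    (hxy : ¬ G.Adj x y) : #(G.neighborFinset x ∩ G.neighborFinset y) = m := by
  rw [← h.of_not_adj hne hxy, ← Set.toFinset_card]
  congr 1
  ext z
  simp [mem_commonNeighbors]

/-- In a connected non-complete strongly regular graph, nonadjacent vertices have a common
neighbour. -/
theorem IsSRGWith.mu_pos (h : G.IsSRGWith v k l m) (hconn : G.Connected) (hnc : G ≠ ⊤) :
    0 < m := by
  by_contra! hm
  obtain rfl : m = 0 := by omega
  -- With `μ = 0` no two vertices are at distance two, so walks collapse to edges.
  have trans : ∀ x y z, G.Adj x y → G.Adj y z → x = z ∨ G.Adj x z := fun x y z hxy hyz => by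
    by_contra! hxz
    have := h.card_inter_of_not_adj hxz.1 hxz.2
    rw [Finset.card_eq_zero] at this
    have hy : y ∈ G.neighborFinset x ∩ G.neighborFinset z := by simp [hxy, hyz.symm]
    simp [this] at hy
  have key : ∀ x y, G.Walk x y → x = y ∨ G.Adj x y := fun x y p => by
    induction p with
    | nil => exact Or.inl rfl
    | cons hxy _ ih =>
      rcases ih with rfl | hyz
      · exact Or.inr hxy
      · exact trans _ _ _ hxy hyz
  apply hnc
  ext x y
  rw [top_adj]
  refine ⟨fun hxy => hxy.ne, fun hne => ?_⟩
  obtain ⟨p⟩ := hconn.preconnected x y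
  exact (key x y p).resolve_left hne

/-- The neighbourhood of an edge has `2k - λ` vertices, including the ends of the edge. -/
theorem IsSRGWith.card_union_of_adj (h : G.IsSRGWith v k l m) {x y : V} (hxy : G.Adj x y) :
    #(G.neighborFinset x ∪ G.neighborFinset y) + l = 2 * k := by
  have := card_union_add_card_inter (G.neighborFinset x) (G.neighborFinset y)
  rw [h.card_inter_of_adj hxy, h.card_neighborFinset, h.card_neighborFinset] at this
  omega

/-- The third neighbourhood meets that of `y` in `l` vertices and that of `x` in `l` or `m`, so it
adds at least `k - l - max l m` to the `2k - l` of the edge `xy`. -/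
theorem IsSRGWith.card_union_of_path (h : G.IsSRGWith v k l m) {x y z : V} (hxy : G.Adj x y)
    (hyz : G.Adj y z) (hxz : x ≠ z) :
    3 * k ≤ #(G.neighborFinset x ∪ G.neighborFinset y ∪ G.neighborFinset z) + 2 * l + max l m := by
  have h1 := card_union_add_card_inter (G.neighborFinset x ∪ G.neighborFinset y)
    (G.neighborFinset z)
  have h2 := h.card_union_of_adj hxy
  have h3 := card_union_le (G.neighborFinset x ∩ G.neighborFinset z)
    (G.neighborFinset y ∩ G.neighborFinset z)
  rw [← union_inter_distrib_right, h.card_inter_of_adj hyz] at h3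
  rw [h.card_neighborFinset] at h1
  have h4 : #(G.neighborFinset x ∩ G.neighborFinset z) ≤ max l m := by
    by_cases ha : G.Adj x z
    · rw [h.card_inter_of_adj ha]; exact le_max_left _ _
    · rw [h.card_inter_of_not_adj hxz ha]; exact le_max_right _ _
  omega

/-- A vertex set containing an edge, separated from the rest by fewer than `2k - λ - 2` vertices,
is large. -/
theorem IsSRGWith.three_mul_le_of_separated (h : G.IsSRGWith v k l m) {A S : Finset V}
    (hA : ∀ x ∈ A, ∀ y, G.Adj x y → y ∈ A ∪ S) (hedge : ∃ x ∈ A, ∃ y ∈ A, G.Adj x y)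
    (hS : #S + l + 2 < 2 * k) : 3 * k ≤ #A + #S + 2 * l + max l m := by
  have hsub : ∀ x ∈ A, G.neighborFinset x ⊆ A ∪ S := fun x hx y hy =>
    hA x hx y (by simpa using hy)
  obtain ⟨x, hx, y, hy, hxy⟩ := hedge
  have hcard := h.card_union_of_adj hxy
  -- `S ∪ {x, y}` has fewer than `2k - l` vertices, so the edge extends to a path inside `A`.
  have : ∃ z ∈ G.neighborFinset x ∪ G.neighborFinset y, z ∉ S ∪ {x, y} := by
    by_contra! hcon
    have h1 := card_le_card (show G.neighborFinset x ∪ G.neighborFinset y ⊆ S ∪ {x, y} from hcon)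
    have h2 := card_union_le S {x, y}
    have h3 : #({x, y} : Finset V) ≤ 2 := card_le_two
    omega
  obtain ⟨z, hz, hzn⟩ := this
  simp only [mem_union, mem_insert, mem_singleton, not_or] at hzn
  obtain ⟨hzS, hzx, hzy⟩ := hzn
  have hzA : z ∈ A := by
    have := union_subset (hsub x hx) (hsub y hy) hz
    exact (mem_union.1 this).resolve_right hzS
  have h4 : 3 * k ≤
      #(G.neighborFinset x ∪ G.neighborFinset y ∪ G.neighborFinset z) + 2 * l + max l m := by
    rcases mem_union.1 hz with hz | hz
    · rw [union_comm (G.neighborFinset x)]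
      exact h.card_union_of_path hxy.symm (by simpa using hz) (Ne.symm hzy)
    · exact h.card_union_of_path hxy (by simpa using hz) (Ne.symm hzx)
  have h5 := card_le_card (union_subset (union_subset (hsub x hx) (hsub y hy)) (hsub z hzA))
  have h6 := card_union_le A S
  omega

/-- Two separated vertex sets, each containing an edge, are separated by at least `2k - λ - 2`
vertices. -/
theorem IsSRGWith.two_mul_le_card_of_separates (h : G.IsSRGWith v k l m) (hm : 0 < m)
    (hl4 : 4 * l ≤ k) (hm4 : 4 * m ≤ k) {A B S : Finset V} (hAB : Disjoint A B)
    (hS : S = (A ∪ B)ᶜ) (hno : ∀ x ∈ A, ∀ y ∈ B, ¬ G.Adj x y)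
    (hAe : ∃ x ∈ A, ∃ y ∈ A, G.Adj x y) (hBe : ∃ x ∈ B, ∃ y ∈ B, G.Adj x y) :
    2 * k ≤ #S + l + 2 := by
  by_contra! hlt
  have hlk : l < k := by omega
  have hBn : B.Nonempty := hBe.imp fun _ hx => hx.1
  have : Nonempty V := ⟨hBn.choose⟩
  have hcardS : #A + #B + #S = v := by
    rw [hS, ← card_union_of_disjoint hAB, card_add_card_compl, h.card]
  have hA := h.three_mul_le_of_separated (A := A) (S := S) (fun x hx y hxy => by
    have := hno x hx y
    simp only [hS, mem_union, mem_compl]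
    tauto) hAe hlt
  have hB := h.three_mul_le_of_separated (A := B) (S := S) (fun x hx y hxy => by
    have := fun hy => hno y hy x hx hxy.symm
    simp only [hS, mem_union, mem_compl]
    tauto) hBe hlt
  have hM : 4 * max l m ≤ k := by
    rcases max_cases l m with ⟨h1, _⟩ | ⟨h1, _⟩ <;> rw [h1] <;> assumption
  have hspec := h.four_mul_card_mul_card_le hlk hBn hAB hno
  have hpar := h.real_param_eq hlk
  -- From `|S| ≤ 2k - l - 3`: `|A| ≥ k - l - max l m + 3 ≥ k / 2 + 3`.
  have hA' : (k : ℝ) + 6 ≤ 2 * #A := by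
    have : k + 6 ≤ 2 * #A := by omega
    exact_mod_cast this
  have hB' : (k : ℝ) + 6 ≤ 2 * #B := by
    have : k + 6 ≤ 2 * #B := by omega
    exact_mod_cast this
  have hs : (#S : ℝ) + l + 3 ≤ 2 * k := by exact_mod_cast hlt
  have hv : (#A : ℝ) + #B + #S = v := by exact_mod_cast hcardS
  have hm1 : (1 : ℝ) ≤ m := by exact_mod_cast hm
  have hl' : 4 * (l : ℝ) ≤ k := by exact_mod_cast hl4
  have hm' : 4 * (m : ℝ) ≤ k := by exact_mod_cast hm4
  have hl0 : (0 : ℝ) ≤ l := Nat.cast_nonneg _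
  have hs0 : (0 : ℝ) ≤ #S := Nat.cast_nonneg _
  rw [← hv] at hspec hpar
  clear hA hB hM hcardS hlt hv
  generalize (#A : ℝ) = a at *
  generalize (#B : ℝ) = b at *
  generalize (#S : ℝ) = s at *
  generalize (k : ℝ) = K at *
  generalize (l : ℝ) = L at *
  generalize (m : ℝ) = M at *
  have hK : 4 ≤ K := by linarith
  have hprod : (K + 6) * (2 * (a + b) - (K + 6)) ≤ 4 * (a * b) := by
    nlinarith [mul_nonneg (sub_nonneg.2 hA') (sub_nonneg.2 hB')]
  have hsq : (L - M) ^ 2 ≤ K ^ 2 / 16 := by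
    nlinarith
  have hupper : ((L - M) ^ 2 + 4 * (K - M)) * (a + b + s - a - b) ≤
      (K ^ 2 / 16 + 4 * K - 4) * (2 * K - 3) := by
    rw [show a + b + s - a - b = s by ring]
    apply mul_le_mul <;> nlinarith
  -- The left side is the value at the extreme case `L = M = K / 4`, `s = 2K - L - 3`.
  have hP : 7 / 16 * K ^ 2 - 3 / 4 * K ≤ M * ((a + b) - (K + 6) / 2) := by
    have h1 : M * (a + b) = K * (K - L - 1) + M * (K + 1) - M * s := by linarith
    have h2 : M * s ≤ M * (2 * K - L - 3) := by gcongr; linarith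
    have h3 : 0 ≤ (K / 4 - L) * (K - M) := mul_nonneg (by linarith) (by linarith)
    have h4 : 0 ≤ (K / 4 - M) * (5 / 4 * K - 1) := mul_nonneg (by linarith) (by linarith)
    nlinarith
  have hlower : (2 * K + 12) * (7 / 16 * K ^ 2 - 3 / 4 * K) ≤ 4 * M * a * b := by
    calc _ ≤ (2 * K + 12) * (M * ((a + b) - (K + 6) / 2)) := by gcongr
      _ = M * ((K + 6) * (2 * (a + b) - (K + 6))) := by ring
      _ ≤ M * (4 * (a * b)) := by gcongr
      _ = _ := by ring
  -- Lower minus upper bound is a cubic in `K - 4` with positive coefficients.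
  nlinarith [mul_nonneg (sub_nonneg.2 hK) (sub_nonneg.2 hK),
    mul_nonneg (mul_nonneg (sub_nonneg.2 hK) (sub_nonneg.2 hK)) (sub_nonneg.2 hK)]

end Counting

/-! ### From components to separated vertex sets -/

section Components

/-- A connected component with at least two vertices contains an edge. -/
theorem exists_adj_of_supp_nontrivial {W : Type*} {H : SimpleGraph W} {C : H.ConnectedComponent}
    (hC : C.supp.Nontrivial) :
    ∃ x y, H.connectedComponentMk x = C ∧ H.connectedComponentMk y = C ∧ H.Adj x y := by
  obtain ⟨x, hx, z, hz, hxz⟩ := hC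
  rw [ConnectedComponent.mem_supp_iff] at hx hz
  obtain ⟨p⟩ := ConnectedComponent.exact (hx.trans hz.symm)
  cases p with
  | nil => exact absurd rfl hxz
  | cons hxy _ =>
    exact ⟨x, _, hx, (ConnectedComponent.connectedComponentMk_eq_of_adj hxy).symm.trans hx, hxy⟩

variable {V : Type*} [Fintype V] [DecidableEq V] {G : SimpleGraph V} [DecidableRel G.Adj]
  {v k l m : ℕ}

theorem IsSRGWith.two_mul_le_card_of_disconnects (h : G.IsSRGWith v k l m) (hm : 0 < m)
    (hl4 : 4 * l ≤ k) (hm4 : 4 * m ≤ k) {S : Finset V} (hS : G.DisconnectsIntoNonsingletons S) :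
    2 * k ≤ #S + l + 2 := by
  classical
  obtain ⟨hS, hnt⟩ := hS
  set H := G.induce {x : V | x ∉ S}
  obtain ⟨C, D, hCD⟩ := hS
  set A : Finset V := {x | ∃ hx : x ∉ S, H.connectedComponentMk ⟨x, hx⟩ = C} with hA
  -- All components other than `C`, so that `A`, `B`, `S` partition the vertices; `D` only supplies
  -- an edge.
  set B : Finset V := {x | ∃ hx : x ∉ S, H.connectedComponentMk ⟨x, hx⟩ ≠ C} with hB
  refine h.two_mul_le_card_of_separates hm hl4 hm4 (A := A) (B := B) ?_ ?_ ?_ ?_ ?_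
  · rw [Finset.disjoint_left]
    intro x hxA hxB
    simp only [hA, hB, mem_filter, mem_univ, true_and] at hxA hxB
    exact hxB.2 hxA.2
  · ext x
    simp only [hA, hB, mem_compl, mem_union, mem_filter, mem_univ, true_and, ← exists_or]
    by_cases hx : x ∈ S
    · simp [hx]
    · simp [hx, em]
  · intro x hxA y hyB hxy
    simp only [hA, hB, mem_filter, mem_univ, true_and] at hxA hyB
    obtain ⟨hx, hxC⟩ := hxA
    obtain ⟨hy, hyC⟩ := hyB
    have hadj : H.Adj ⟨x, hx⟩ ⟨y, hy⟩ := hxy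
    exact hyC ((ConnectedComponent.connectedComponentMk_eq_of_adj hadj).symm.trans hxC)
  · obtain ⟨x, y, hx, hy, hxy⟩ := exists_adj_of_supp_nontrivial (hnt C)
    exact ⟨x, by simpa [hA] using ⟨x.2, hx⟩, y, by simpa [hA] using ⟨y.2, hy⟩, hxy⟩
  · obtain ⟨x, y, hx, hy, hxy⟩ := exists_adj_of_supp_nontrivial (hnt D)
    exact ⟨x, by simpa [hB] using ⟨x.2, hx ▸ hCD.symm⟩, y,
      by simpa [hB] using ⟨y.2, hy ▸ hCD.symm⟩, hxy⟩

/-- Removing the neighbourhood of an edge disconnects the graph into non-singleton components. -/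
theorem IsSRGWith.disconnects_edge_neighborhood (h : G.IsSRGWith v k l m) (hm : 0 < m)
    (hl4 : 4 * l ≤ k) (hm4 : 4 * m ≤ k) {x y : V} (hxy : G.Adj x y) :
    G.DisconnectsIntoNonsingletons ((G.neighborFinset x ∪ G.neighborFinset y) \ {x, y}) := by
  set S := (G.neighborFinset x ∪ G.neighborFinset y) \ {x, y} with hS
  have hmem : ∀ z, z ∉ S ↔ z = x ∨ z = y ∨ (¬ G.Adj x z ∧ ¬ G.Adj y z) := fun z => by
    simp only [hS, mem_sdiff, mem_union, mem_neighborFinset, mem_insert, mem_singleton]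
    tauto
  have hxS : x ∉ S := (hmem x).2 (Or.inl rfl)
  have hyS : y ∉ S := (hmem y).2 (Or.inr (Or.inl rfl))
  have hnbr : ∀ w, w ∉ S → ∃ z, z ∉ S ∧ G.Adj w z := fun w hw => by
    rcases (hmem w).1 hw with rfl | rfl | ⟨hwx, hwy⟩
    · exact ⟨y, hyS, hxy⟩
    · exact ⟨x, hxS, hxy.symm⟩
    by_cases hx : w = x
    · exact ⟨y, hyS, hx ▸ hxy⟩
    by_cases hy : w = y
    · exact ⟨x, hxS, hy ▸ hxy.symm⟩
    by_contra! hcon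
    -- If all `k` neighbours of `w` lay in `S`, each would be shared with `x` or `y`, giving `k ≤ 2
    -- * m`.
    have hsub : G.neighborFinset w ⊆ (G.neighborFinset x ∩ G.neighborFinset w) ∪
        (G.neighborFinset y ∩ G.neighborFinset w) := fun z hz => by
      rw [mem_neighborFinset] at hz
      have hzS : z ∈ S := by
        by_contra hzS
        exact hcon z hzS hz
      have := (mem_sdiff.1 hzS).1
      simp only [mem_union, mem_inter, mem_neighborFinset] at this ⊢
      tauto
    have h1 := (card_le_card hsub).trans (card_union_le _ _)
    rw [h.card_neighborFinset, h.card_inter_of_not_adj (Ne.symm hx) hwx,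
      h.card_inter_of_not_adj (Ne.symm hy) hwy] at h1
    omega
  -- Otherwise `v ≤ 2k - l`, which is too few vertices for the parameter equation.
  have hfar : ∃ w, w ∉ S ∧ w ≠ x ∧ w ≠ y := by
    have : Nonempty V := ⟨x⟩
    by_contra! hcon
    have huniv : (univ : Finset V) ⊆ G.neighborFinset x ∪ G.neighborFinset y := fun w _ => by
      by_cases hw : w ∈ S
      · exact (mem_sdiff.1 hw).1
      · by_cases hwx : w = x
        · simp [hwx, hxy.symm]
        · simp [hcon w hw hwx, hxy]
    have hcard := card_le_card huniv
    rw [card_univ, h.card] at hcard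
    have hu := h.card_union_of_adj hxy
    have hpar := h.real_param_eq (by omega)
    have hv : (v : ℝ) + l ≤ 2 * k := by
      have : v + l ≤ 2 * k := by omega
      exact_mod_cast this
    have hm1 : (1 : ℝ) ≤ m := by exact_mod_cast hm
    have hl' : 4 * (l : ℝ) ≤ k := by exact_mod_cast hl4
    have hm' : 4 * (m : ℝ) ≤ k := by exact_mod_cast hm4
    have hl0 : (0 : ℝ) ≤ l := Nat.cast_nonneg _
    nlinarith [mul_le_mul_of_nonneg_right (show (v : ℝ) - k - 1 ≤ k - 1 by linarith)
      (show (0 : ℝ) ≤ m by linarith), mul_le_mul_of_nonneg_left hm' (show (0 : ℝ) ≤ k by linarith),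
      mul_le_mul_of_nonneg_left hl' (show (0 : ℝ) ≤ k by linarith)]
  refine ⟨?_, fun C => ?_⟩
  · obtain ⟨w, hwS, hwx, hwy⟩ := hfar
    refine ⟨SimpleGraph.connectedComponentMk _ ⟨x, hxS⟩, SimpleGraph.connectedComponentMk _ ⟨w, hwS⟩, fun heq => ?_⟩
    obtain ⟨p⟩ := ConnectedComponent.exact heq
    have key : ∀ (a b : {z : V | z ∉ S}), (G.induce {z : V | z ∉ S}).Walk a b →
        (a.1 = x ∨ a.1 = y) → (b.1 = x ∨ b.1 = y) := fun a b p => by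
      induction p with
      | nil => exact id
      | @cons a c b hac _ ih =>
        intro ha
        apply ih
        have hac' : G.Adj a.1 c.1 := hac
        rcases (hmem c.1).1 c.2 with hc | hc | ⟨hc1, hc2⟩
        · exact Or.inl hc
        · exact Or.inr hc
        · rcases ha with ha | ha
          · exact absurd (ha ▸ hac') hc1
          · exact absurd (ha ▸ hac') hc2
    rcases key _ _ p (Or.inl rfl) with h' | h'
    · exact hwx h'
    · exact hwy h'
  · induction C using ConnectedComponent.ind with
    | h w =>
      obtain ⟨z, hz, hwz⟩ := hnbr w.1 w.2
      have hadj : (G.induce {z : V | z ∉ S}).Adj w ⟨z, hz⟩ := hwz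
      exact ⟨w, rfl, ⟨z, hz⟩,
        (ConnectedComponent.connectedComponentMk_eq_of_adj hadj).symm, hadj.ne⟩

end Components

end SimpleGraph

theorem mainTheorem1 {V : Type*} [Fintype V] [DecidableEq V] (G : SimpleGraph V)
    [DecidableRel G.Adj] (v k l m : ℕ) (hsrg : G.IsSRGWith v k l m) (hconn : G.Connected)
    (hnc : G ≠ ⊤) (hmax : ((max l m : ℕ) : ℝ) ≤ (k : ℝ) / 4) :
    G.IsKappaTwo (2 * (k : ℤ) - (l : ℤ) - 2) := by
  have hmax' : 4 * max l m ≤ k := by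
    have : 4 * ((max l m : ℕ) : ℝ) ≤ k := by linarith
    exact_mod_cast this
  have hl4 : 4 * l ≤ k := (Nat.mul_le_mul_left 4 (le_max_left l m)).trans hmax'
  have hm4 : 4 * m ≤ k := (Nat.mul_le_mul_left 4 (le_max_right l m)).trans hmax'
  have hm := hsrg.mu_pos hconn hnc
  constructor
  · obtain ⟨x⟩ := hconn.nonempty
    obtain ⟨y, hy⟩ : (G.neighborFinset x).Nonempty := by
      rw [← card_pos, hsrg.card_neighborFinset]
      omega
    have hxy : G.Adj x y := by simpa using hy
    refine ⟨_, hsrg.disconnects_edge_neighborhood hm hl4 hm4 hxy, ?_⟩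
    have hsub : ({x, y} : Finset V) ⊆ G.neighborFinset x ∪ G.neighborFinset y := by
      intro z hz
      rcases mem_insert.1 hz with rfl | hz
      · simp [hxy.symm]
      · simp [mem_singleton.1 hz, hxy]
    have h1 := card_sdiff_add_card_eq_card hsub
    rw [card_pair hxy.ne] at h1
    have h2 := hsrg.card_union_of_adj hxy
    omega
  · rintro _ ⟨S, hS, rfl⟩
    have := hsrg.two_mul_le_card_of_disconnects hm hl4 hm4 hS
    omega
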